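/- Let $R$ be an integral domain with quotient field $K$. For a nonzero fractional ideal $I$ of $R$ put $I^{-1}=\{x\in K : xI\subseteq R\}$, $I^v=(I^{-1})^{-1}$, and $I^t=\bigcup J^v$, the union over the nonzero finitely generated fractional ideals $J\subseteq I$. A $t$-ideal is a nonzero ideal $I$ of $R$ with $I^t=I$; a maximal $t$-ideal is a $t$-ideal that is maximal among the $t$-ideals different from $R$. A nonzero ideal $I$ of $R$ is $t$-invertible if $(II^{-1})^t=R$. A nonzero finitely generated ideal $I$ of $R$ is $t$-rigid if it is contained in exactly one maximal $t$-ideal, and $t$-super rigid if, in addition, every finitely generated ideal $J$ of $R$ with $J\supseteq I$ is $t$-invertible. The domain $R$ is $t$-potent (respectively $t$-super potent) if each maximal $t$-ideal of $R$ contains a $t$-rigid (respectively $t$-super rigid) ideal; it has $t$-dimension one if each maximal $t$-ideal of $R$ has height one; it is a PvMD (Prüfer $v$-multiplication domain) if each nonzero finitely generated ideal of $R$ is $t$-invertible; it is completely integrally closed if, whenever $u\in K$ and $0\neq a\in R$ satisfy $au^n\in R$ for all $n\ge 1$, then $u\in R$. A set $\mathcal P$ of prime ideals of $R$ is a defining family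 if $R=\bigcap_{P\in\mathcal P}R_P$ in $K$ (the empty intersection being $K$); it has finite character if each nonzero element of $R$ lies in at most finitely many members of $\mathcal P$. A prime $P$ is essential if $R_P$ is a valuation domain. $R$ is an essential domain if it has a defining family of essential primes, and a generalized Krull domain if it has a finite-character defining family of essential primes of height one. Theorem. For an integral domain $R$ the following statements are equivalent: 1. $R$ is a generalized Krull domain. 2. $R$ is a $t$-potent essential domain of $t$-dimension one. 3. $R$ is a $t$-potent PvMD of $t$-dimension one. 4. $R$ is a completely integrally closed $t$-super potent domain. 5. $R$ is a $t$-super potent domain of $t$-dimension one. (A field has no maximal $t$-ideals and satisfies all five conditions.) -/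

import Mathlib

open scoped nonZeroDivisors

namespace TOperation

variable {R K : Type*} [CommRing R] [IsDomain R] [Field K] [Algebra R K] [IsFractionRing R K]

/-- The `v`-operation `I ↦ (I⁻¹)⁻¹` on the fractional ideals of `R` in its quotient field `K`,
where `I⁻¹ = {x ∈ K | x I ⊆ R}` for `I ≠ 0` (and `0 ↦ 0`). -/
noncomputable def vClosure (I : FractionalIdeal R⁰ K) : FractionalIdeal R⁰ K := (I⁻¹)⁻¹

theorem inv_ne_zero_of_ne_zero {I : FractionalIdeal R⁰ K} (hI : I ≠ 0) : I⁻¹ ≠ 0 := by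
  intro h
  have := FractionalIdeal.bot_lt_mul_inv (I := I) hI
  rw [h, mul_zero] at this
  exact lt_irrefl _ this

theorem vClosure_mono {I J : FractionalIdeal R⁰ K} (h : I ≤ J) : vClosure I ≤ vClosure J := by
  by_cases hI : I = 0
  · subst hI
    simp [vClosure, FractionalIdeal.inv_zero']
  · have hJ : J ≠ 0 := fun h0 => hI (le_antisymm (h0 ▸ h) (FractionalIdeal.zero_le _))
    exact FractionalIdeal.inv_anti_mono (inv_ne_zero_of_ne_zero hJ) (inv_ne_zero_of_ne_zero hI)
      (FractionalIdeal.inv_anti_mono hI hJ h)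

/-- The submodule of `K` which is the union of the `J^v` over the finitely generated fractional
ideals `J` contained in `I`. -/
noncomputable def tSubmodule (I : FractionalIdeal R⁰ K) : Submodule R K where
  carrier := {x | ∃ J : FractionalIdeal R⁰ K, (J : Submodule R K).FG ∧ J ≤ I ∧ x ∈ vClosure J}
  add_mem' := by
    rintro x y ⟨J, hJ, hJI, hx⟩ ⟨L, hL, hLI, hy⟩
    refine ⟨J ⊔ L, ?_, sup_le hJI hLI, ?_⟩
    · rw [FractionalIdeal.coe_sup]
      exact hJ.sup hL
    · exact Submodule.add_mem (vClosure (J ⊔ L) : Submodule R K)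
        (vClosure_mono (le_sup_left : J ≤ J ⊔ L) hx) (vClosure_mono (le_sup_right : L ≤ J ⊔ L) hy)
  zero_mem' :=
    ⟨0, by rw [FractionalIdeal.coe_zero]; exact Submodule.fg_bot, FractionalIdeal.zero_le _,
      Submodule.zero_mem (vClosure (0 : FractionalIdeal R⁰ K) : Submodule R K)⟩
  smul_mem' := by
    rintro r x ⟨J, hJ, hJI, hx⟩
    exact ⟨J, hJ, hJI, Submodule.smul_mem (vClosure J : Submodule R K) r hx⟩

/-- The `t`-operation: `I^t = ⋃ J^v`, the union over the finitely generated fractional ideals `J`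
contained in `I`. -/
noncomputable def tClosure (I : FractionalIdeal R⁰ K) : FractionalIdeal R⁰ K :=
  ⟨tSubmodule I, FractionalIdeal.isFractional_of_le (J := vClosure I)
    (by rintro x ⟨J, -, hJI, hx⟩; exact vClosure_mono hJI hx)⟩

variable (K)

/-- A proper integral `t`-ideal: a nonzero ideal `I ≠ R` of `R` with `I^t = I`. -/
def IsProperTIdeal (I : Ideal R) : Prop :=
  I ≠ ⊥ ∧ I ≠ ⊤ ∧ tClosure (I : FractionalIdeal R⁰ K) = I

/-- A maximal `t`-ideal: an ideal maximal among the proper `t`-ideals. -/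
def IsMaximalTIdeal (M : Ideal R) : Prop := Maximal (IsProperTIdeal K) M

/-- A nonzero ideal `I` is `t`-invertible if `(I I⁻¹)^t = R`. -/
def IsTInvertible (I : Ideal R) : Prop :=
  I ≠ ⊥ ∧ tClosure ((I : FractionalIdeal R⁰ K) * (I : FractionalIdeal R⁰ K)⁻¹) = 1

/-- A nonzero finitely generated ideal is `t`-rigid if it is contained in exactly one maximal
`t`-ideal. -/
def IsTRigid (I : Ideal R) : Prop :=
  I ≠ ⊥ ∧ I.FG ∧ ∃! M : Ideal R, IsMaximalTIdeal K M ∧ I ≤ M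

/-- A `t`-rigid ideal `I` is `t`-super rigid if every finitely generated ideal `J ⊇ I` is
`t`-invertible. -/
def IsTSuperRigid (I : Ideal R) : Prop :=
  IsTRigid K I ∧ ∀ J : Ideal R, J.FG → I ≤ J → IsTInvertible K J

variable (R)

/-- `R` is `t`-potent: every maximal `t`-ideal contains a `t`-rigid ideal. -/
def IsTPotent : Prop :=
  ∀ M : Ideal R, IsMaximalTIdeal K M → ∃ I : Ideal R, IsTRigid K I ∧ I ≤ M

/-- `R` is `t`-super potent: every maximal `t`-ideal contains a `t`-super rigid ideal. -/
def IsTSuperPotent : Prop :=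
  ∀ M : Ideal R, IsMaximalTIdeal K M → ∃ I : Ideal R, IsTSuperRigid K I ∧ I ≤ M

/-- `R` has `t`-dimension one: every maximal `t`-ideal has height one. -/
def HasTDimensionOne : Prop :=
  ∀ M : Ideal R, IsMaximalTIdeal K M → M.height = 1

/-- `R` is a Prüfer `v`-multiplication domain: every nonzero finitely generated ideal is
`t`-invertible. -/
def IsPvMD : Prop :=
  ∀ I : Ideal R, I ≠ ⊥ → I.FG → IsTInvertible K I

/-- `R` is completely integrally closed: an element `u` of the quotient field `K` for which some
nonzero `a : R` has `a u ^ n ∈ R` for all `n` lies in `R`. -/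
def IsCompletelyIntegrallyClosed : Prop := completeIntegralClosure R K = ⊥

variable {R}

/-- The localization `R_P`, as a subring of `K`. -/
noncomputable def localizationAt (P : PrimeSpectrum R) : Subalgebra R K :=
  Localization.subalgebra.ofField K P.asIdeal.primeCompl P.asIdeal.primeCompl_le_nonZeroDivisors

/-- A prime `P` is essential if `R_P` is a valuation domain. -/
def IsEssentialPrime (P : PrimeSpectrum R) : Prop := ValuationRing (localizationAt K P)

/-- A set `F` of primes is a defining family if `R = ⋂_{P ∈ F} R_P` in `K` (the intersection of
the empty family being `K`). -/
def IsDefiningFamily (F : Set (PrimeSpectrum R)) : Prop := ⨅ P ∈ F, localizationAt K P = ⊥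

/-- A family of primes has finite character if each nonzero element of `R` lies in only finitely
many of its members. -/
def HasFiniteCharacter (F : Set (PrimeSpectrum R)) : Prop :=
  ∀ a : R, a ≠ 0 → {P ∈ F | a ∈ P.asIdeal}.Finite

variable (R)

/-- `R` is an essential domain: it has a defining family of essential primes. -/
def IsEssentialDomain : Prop :=
  ∃ F : Set (PrimeSpectrum R), IsDefiningFamily K F ∧ ∀ P ∈ F, IsEssentialPrime K P

/-- `R` is a generalized Krull domain: it has a defining family of finite character that consists
of essential primes of height one. -/
def IsGeneralizedKrullDomain : Prop :=
  ∃ F : Set (PrimeSpectrum R), IsDefiningFamily K F ∧ HasFiniteCharacter F ∧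
    ∀ P ∈ F, P.asIdeal.height = 1 ∧ IsEssentialPrime K P

end TOperation

set_option linter.unusedSectionVars false

namespace TOperation

/-! ### Ideals with proper `t`-closure and maximal `t`-ideals -/

variable {R K : Type*} [CommRing R] [IsDomain R] [Field K] [Algebra R K] [IsFractionRing R K]

/-! The closures are first eliminated: `1 ∈ A^t` means that some finitely generated `J ⊆ A` has `J⁻¹
⊆ R`. Maximal `t`-ideals are the ideals maximal for the failure of this; they are prime, `R` is the
intersection of the `R_M`, and `t`-invertible ideals are locally principal at each `M`. The rest is
divisibility in `R_M`, written `DvdAt M`.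

From 1, prime avoidance and finite character show that every maximal `t`-ideal belongs to the given
family and contains a `t`-rigid ideal `(a, b)`. In 2, a `t`-rigid ideal of `M` lies in some
essential prime, which rigidity and height one identify with `M`; so each `R_M` is a valuation ring
and 3 follows. That 3 gives 5 is immediate.

In 4 or 5, a `t`-super rigid ideal of `M` has a local generator `c`, and two elements are comparable
at `M` unless `c` divides both (`IsTSuperRigid.exists_generator`). In height one no nonzero element
is divisible by all powers of `c`, so cancelling `c` makes `R_M` a valuation ring; finite character
comes from `IsTPotent.finite_setOf_mem`. Thus 5 gives 1, and 4 because valuation rings of height one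
are completely integrally closed. In 4, complete integral closure replaces height one in bounding
the powers of `c`, and it forces every nonzero prime inside `M` to be `M`. -/

/-- The inverse of the ideal `J` is contained in `R`. -/
def HasTrivialInverse (K : Type*) [Field K] [Algebra R K] (J : Ideal R) : Prop :=
  ∀ u : K, (∀ j ∈ J, u * algebraMap R K j ∈ (algebraMap R K).range) → u ∈ (algebraMap R K).range

theorem HasTrivialInverse.mono {I J : Ideal R} (hI : HasTrivialInverse K I) (h : I ≤ J) :
    HasTrivialInverse K J :=
  fun u hu => hI u fun j hj => hu j (h hj)

theorem hasTrivialInverse_top : HasTrivialInverse K (⊤ : Ideal R) := fun u hu => by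
  simpa using hu 1 trivial

theorem HasTrivialInverse.mul {I J : Ideal R} (hI : HasTrivialInverse K I)
    (hJ : HasTrivialInverse K J) : HasTrivialInverse K (I * J) := by
  intro u hu
  refine hI u fun i hi => hJ _ fun j hj => ?_
  rw [mul_assoc, ← map_mul]
  exact hu _ (Ideal.mul_mem_mul hi hj)

variable (K) in
/-- A nonzero ideal whose `t`-closure is not `R`: the inverse of a finitely generated subideal is
never contained in `R`. -/
def IsTProper (A : Ideal R) : Prop :=
  A ≠ ⊥ ∧ ∀ J ≤ A, J.FG → ¬ HasTrivialInverse K J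

theorem IsTProper.ne_top {A : Ideal R} (hA : IsTProper K A) : A ≠ ⊤ := by
  rintro rfl
  exact hA.2 ⊤ le_rfl Module.Finite.fg_top hasTrivialInverse_top

theorem exists_fg_of_not_isTProper {A : Ideal R} (h0 : A ≠ ⊥) (hA : ¬ IsTProper K A) :
    ∃ J ≤ A, J ≠ ⊥ ∧ J.FG ∧ HasTrivialInverse K J := by
  simp only [IsTProper, not_and, not_forall, not_not] at hA
  obtain ⟨J, hJA, hJ, hJt⟩ := hA h0
  obtain ⟨a, ha, ha0⟩ := Submodule.exists_mem_ne_zero_of_ne_bot h0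
  -- Over a field the zero ideal has trivial inverse, so a nonzero element is added.
  refine ⟨J ⊔ Ideal.span {a}, sup_le hJA ((Ideal.span_singleton_le_iff_mem _).2 ha), fun h => ha0 ?_,
    Submodule.FG.sup hJ (Submodule.fg_span_singleton a), hJt.mono le_sup_left⟩
  have : a ∈ J ⊔ Ideal.span {a} := Ideal.mem_sup_right (Ideal.mem_span_singleton_self a)
  simpa [h] using this

/-- Zorn applies because finitely generated ideals are compact: one inside the union of a chain lies
in a member. -/
theorem IsTProper.exists_le_maximal {A : Ideal R} (hA : IsTProper K A) :
    ∃ M, A ≤ M ∧ Maximal (IsTProper K) M := by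
  refine zorn_le_nonempty₀ {B : Ideal R | IsTProper K B} (fun c hc hchain B hB => ?_) A hA
  refine ⟨sSup c, ⟨fun h => (hc hB).1 (le_bot_iff.1 (h ▸ le_sSup hB)), fun J hJ hfg => ?_⟩,
    fun z hz => le_sSup hz⟩
  obtain ⟨C, hC, hJC⟩ := (Submodule.fg_iff_compact J).1 hfg c (sSup c) ⟨B, hB⟩
    hchain.directedOn (isLUB_sSup c) hJ
  exact (hc hC).2 J hJC hfg

/-- Finitely generated subideals of a sum of two ideals come from finitely generated ones. -/
theorem exists_fg_le_sup {A B J : Ideal R} (hJ : J.FG) (h : J ≤ A ⊔ B) :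
    ∃ A' ≤ A, A'.FG ∧ J ≤ A' ⊔ B := by
  obtain ⟨T, rfl⟩ := hJ
  have key : ∀ t : T, ∃ m ∈ A, ∃ b ∈ B, m + b = t := fun t =>
    Submodule.mem_sup.1 (h (Submodule.subset_span t.2))
  choose m hm b hb hmb using key
  refine ⟨Ideal.span (Set.range m), Ideal.span_le.2 (Set.range_subset_iff.2 hm),
    Submodule.fg_span (Set.finite_range m), Submodule.span_le.2 fun t ht => ?_⟩
  exact Submodule.mem_sup.2 ⟨_, Ideal.subset_span ⟨⟨t, ht⟩, rfl⟩, _, hb ⟨t, ht⟩, hmb _⟩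

theorem not_isTProper_sup {M : Ideal R} (hM : Maximal (IsTProper K) M) {r : R} (hr : r ∉ M) :
    ∃ J ≤ M, J.FG ∧ HasTrivialInverse K (J ⊔ Ideal.span {r}) := by
  have hn : ¬ IsTProper K (M ⊔ Ideal.span {r}) := fun h => hr <|
    hM.2 h le_sup_left (Ideal.mem_sup_right (Ideal.mem_span_singleton_self r))
  obtain ⟨N, hN, -, hNfg, hNt⟩ := exists_fg_of_not_isTProper
    (fun h => hM.prop.1 (le_bot_iff.1 (h ▸ le_sup_left))) hn
  obtain ⟨J, hJ, hJfg, hNJ⟩ := exists_fg_le_sup hNfg hN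
  exact ⟨J, hJ, hJfg, hNt.mono hNJ⟩

/-- If `ab ∈ M`, then `(J + aR)(L + bR) ⊆ M` for `J, L ⊆ M`, while trivial inverses are stable under
products. -/
theorem isPrime_of_maximal_isTProper {M : Ideal R} (hM : Maximal (IsTProper K) M) :
    M.IsPrime := by
  refine ⟨hM.prop.ne_top, fun {a b} hab => ?_⟩
  by_contra! h
  obtain ⟨J, hJ, hJfg, hJt⟩ := not_isTProper_sup hM h.1
  obtain ⟨L, hL, hLfg, hLt⟩ := not_isTProper_sup hM h.2
  have hfg : ((J ⊔ Ideal.span {a}) * (L ⊔ Ideal.span {b})).FG :=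
    Submodule.FG.mul (Submodule.FG.sup hJfg (Submodule.fg_span_singleton a))
      (Submodule.FG.sup hLfg (Submodule.fg_span_singleton b))
  refine hM.prop.2 _ ?_ hfg (hJt.mul hLt)
  rw [Ideal.sup_mul, Ideal.mul_sup, Ideal.mul_sup, Ideal.span_singleton_mul_span_singleton]
  exact sup_le (sup_le (Ideal.mul_le_left.trans hJ) (Ideal.mul_le_left.trans hJ))
    (sup_le (Ideal.mul_le_right.trans hL) ((Ideal.span_singleton_le_iff_mem _).2 hab))

/-! ### Elementwise descriptions of the `v`- and `t`-closures -/

theorem mem_coeIdeal_inv_iff {J : Ideal R} (hJ : J ≠ ⊥) {u : K} :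
    u ∈ (J : FractionalIdeal R⁰ K)⁻¹ ↔
      ∀ j ∈ J, u * algebraMap R K j ∈ (algebraMap R K).range := by
  rw [FractionalIdeal.mem_inv_iff (FractionalIdeal.coeIdeal_ne_zero.2 hJ)]
  simp only [FractionalIdeal.mem_coeIdeal, FractionalIdeal.mem_one_iff, RingHom.mem_range]
  constructor
  · intro h j hj
    exact h _ ⟨j, hj, rfl⟩
  · rintro h _ ⟨j, hj, rfl⟩
    exact h j hj

theorem mem_vClosure_coeIdeal_iff {J : Ideal R} (hJ : J ≠ ⊥) {x : K} :
    x ∈ vClosure (J : FractionalIdeal R⁰ K) ↔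
      ∀ u : K, (∀ j ∈ J, u * algebraMap R K j ∈ (algebraMap R K).range) →
        x * u ∈ (algebraMap R K).range := by
  rw [vClosure, FractionalIdeal.mem_inv_iff
    (inv_ne_zero_of_ne_zero (FractionalIdeal.coeIdeal_ne_zero.2 hJ))]
  simp only [mem_coeIdeal_inv_iff hJ, FractionalIdeal.mem_one_iff, RingHom.mem_range]

theorem one_mem_vClosure_iff {J : Ideal R} (hJ : J ≠ ⊥) :
    (1 : K) ∈ vClosure (J : FractionalIdeal R⁰ K) ↔ HasTrivialInverse K J := by
  simp [mem_vClosure_coeIdeal_iff hJ, HasTrivialInverse]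

theorem mem_tClosure_iff {I : FractionalIdeal R⁰ K} {x : K} : x ∈ tClosure I ↔
    ∃ J : FractionalIdeal R⁰ K, (J : Submodule R K).FG ∧ J ≤ I ∧ x ∈ vClosure J := Iff.rfl

theorem tClosure_mono {I J : FractionalIdeal R⁰ K} (h : I ≤ J) : tClosure I ≤ tClosure J := by
  rintro x ⟨L, hL, hLI, hx⟩
  exact ⟨L, hL, hLI.trans h, hx⟩

theorem le_vClosure (I : FractionalIdeal R⁰ K) : I ≤ vClosure I := by
  by_cases hI : I = 0
  · subst hI
    exact FractionalIdeal.zero_le _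
  · intro x hx
    rw [vClosure, FractionalIdeal.mem_inv_iff (inv_ne_zero_of_ne_zero hI)]
    intro y hy
    rw [mul_comm]
    exact (FractionalIdeal.mem_inv_iff hI).1 hy x hx

theorem mem_tClosure_coeIdeal_iff {A : Ideal R} (hA : A ≠ ⊥) {x : K} :
    x ∈ tClosure (A : FractionalIdeal R⁰ K) ↔
      ∃ J ≤ A, J ≠ ⊥ ∧ J.FG ∧ x ∈ vClosure (J : FractionalIdeal R⁰ K) := by
  have inj : Function.Injective (algebraMap R K) := IsFractionRing.injective R K
  rw [mem_tClosure_iff]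
  constructor
  · rintro ⟨J, hJ, hJA, hx⟩
    obtain ⟨J, rfl⟩ := FractionalIdeal.le_one_iff_exists_coeIdeal.1
      (hJA.trans FractionalIdeal.coeIdeal_le_one)
    rw [FractionalIdeal.coeIdeal_fg _ inj] at hJ
    rw [FractionalIdeal.coeIdeal_le_coeIdeal] at hJA
    obtain ⟨a, ha, ha0⟩ := Submodule.exists_mem_ne_zero_of_ne_bot hA
    refine ⟨J ⊔ Ideal.span {a}, sup_le hJA ((Ideal.span_singleton_le_iff_mem _).2 ha),
      fun h => ha0 ?_, Submodule.FG.sup hJ (Submodule.fg_span_singleton a),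
      vClosure_mono ((FractionalIdeal.coeIdeal_le_coeIdeal K).2 le_sup_left) hx⟩
    have : a ∈ J ⊔ Ideal.span {a} := Ideal.mem_sup_right (Ideal.mem_span_singleton_self a)
    simpa [h] using this
  · rintro ⟨J, hJA, -, hJ, hx⟩
    exact ⟨J, (FractionalIdeal.coeIdeal_fg _ inj J).2 hJ,
      (FractionalIdeal.coeIdeal_le_coeIdeal K).2 hJA, hx⟩

theorem coeIdeal_le_tClosure (A : Ideal R) :
    (A : FractionalIdeal R⁰ K) ≤ tClosure (A : FractionalIdeal R⁰ K) := by
  by_cases hA : A = ⊥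
  · subst hA
    rw [FractionalIdeal.coeIdeal_bot]
    exact FractionalIdeal.zero_le _
  · intro y hy
    obtain ⟨x, hx, rfl⟩ := (FractionalIdeal.mem_coeIdeal _).1 hy
    refine ⟨(Ideal.span {x} : Ideal R), ?_, ?_, le_vClosure _ ?_⟩
    · exact (FractionalIdeal.coeIdeal_fg _ (IsFractionRing.injective R K) _).2
        (Submodule.fg_span_singleton x)
    · exact (FractionalIdeal.coeIdeal_le_coeIdeal K).2 ((Ideal.span_singleton_le_iff_mem _).2 hx)
    · exact FractionalIdeal.mem_coeIdeal_of_mem _ (Ideal.mem_span_singleton_self x)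

theorem IsProperTIdeal.isTProper {I : Ideal R} (hI : IsProperTIdeal K I) : IsTProper K I := by
  by_contra h
  obtain ⟨J, hJI, hJ0, hJ, hJt⟩ := exists_fg_of_not_isTProper hI.1 h
  have h1 : (1 : K) ∈ tClosure (I : FractionalIdeal R⁰ K) :=
    (mem_tClosure_coeIdeal_iff hI.1).2 ⟨J, hJI, hJ0, hJ, (one_mem_vClosure_iff hJ0).2 hJt⟩
  rw [hI.2.2, FractionalIdeal.mem_coeIdeal] at h1
  obtain ⟨r, hr, hr1⟩ := h1
  rw [← map_one (algebraMap R K)] at hr1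
  exact hI.2.1 ((Ideal.eq_top_iff_one _).2 (IsFractionRing.injective R K hr1 ▸ hr))

theorem vClosure_coeIdeal_le_one (J : Ideal R) :
    vClosure (J : FractionalIdeal R⁰ K) ≤ 1 := by
  by_cases hJ : J = ⊥
  · simp [hJ, vClosure, FractionalIdeal.inv_zero']
  · intro x hx
    rw [mem_vClosure_coeIdeal_iff hJ] at hx
    have := hx 1 fun j _ => ⟨j, by simp⟩
    rwa [mul_one, RingHom.mem_range, ← FractionalIdeal.mem_one_iff R⁰] at this

/-- Suppose `r ∈ J^v` with `J ⊆ M` but `r ∉ M`. Some `N ⊆ M` makes `N + rR` have trivial inverse;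
any `u` carrying `J + N` into `R` carries `r` there too, so `J + N ⊆ M` has trivial inverse. -/
theorem isProperTIdeal_of_maximal {M : Ideal R} (hM : Maximal (IsTProper K) M) :
    IsProperTIdeal K M := by
  refine ⟨hM.prop.1, hM.prop.ne_top, le_antisymm ?_ (coeIdeal_le_tClosure M)⟩
  intro x hx
  obtain ⟨J, hJM, hJ0, hJ, hx⟩ := (mem_tClosure_coeIdeal_iff hM.prop.1).1 hx
  obtain ⟨r, rfl⟩ := (FractionalIdeal.mem_one_iff R⁰).1 (vClosure_coeIdeal_le_one J hx)
  refine FractionalIdeal.mem_coeIdeal_of_mem _ ?_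
  by_contra hr
  obtain ⟨N, hN, hNfg, hNt⟩ := not_isTProper_sup hM hr
  refine hM.prop.2 (J ⊔ N) (sup_le hJM hN) (Submodule.FG.sup hJ hNfg) fun u hu => hNt u fun j hj => ?_
  obtain ⟨n, hn, b, hb, rfl⟩ := Submodule.mem_sup.1 hj
  obtain ⟨k, rfl⟩ := Ideal.mem_span_singleton'.1 hb
  rw [map_add, mul_add]
  refine add_mem (hu n (Ideal.mem_sup_right hn)) ?_
  have := (mem_vClosure_coeIdeal_iff hJ0).1 hx u fun j hj => hu j (Ideal.mem_sup_left hj)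
  rw [map_mul, mul_left_comm, mul_comm u]
  exact mul_mem ⟨k, rfl⟩ this

/-- Ideals satisfying `IsTProper` need not be `t`-ideals, but each lies under a maximal one, which
is. -/
theorem isMaximalTIdeal_iff {M : Ideal R} :
    IsMaximalTIdeal K M ↔ Maximal (IsTProper K) M := by
  constructor
  · intro hM
    refine ⟨hM.prop.isTProper, fun N hN hMN => ?_⟩
    obtain ⟨L, hNL, hL⟩ := hN.exists_le_maximal
    exact hNL.trans (hM.2 (isProperTIdeal_of_maximal hL) (hMN.trans hNL))
  · intro hM
    exact ⟨isProperTIdeal_of_maximal hM, fun N hN hMN => hM.2 hN.isTProper hMN⟩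

theorem IsMaximalTIdeal.isTProper {M : Ideal R} (hM : IsMaximalTIdeal K M) : IsTProper K M :=
  hM.prop.isTProper

theorem IsMaximalTIdeal.isPrime {M : Ideal R} (hM : IsMaximalTIdeal K M) : M.IsPrime :=
  isPrime_of_maximal_isTProper (isMaximalTIdeal_iff.1 hM)

theorem IsTProper.exists_le_isMaximalTIdeal {A : Ideal R} (hA : IsTProper K A) :
    ∃ M, IsMaximalTIdeal K M ∧ A ≤ M := by
  obtain ⟨M, hAM, hM⟩ := hA.exists_le_maximal
  exact ⟨M, isMaximalTIdeal_iff.2 hM, hAM⟩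

/-- `R` is the intersection of its localizations at the maximal `t`-ideals. -/
theorem mem_range_of_forall_isMaximalTIdeal {x : K}
    (h : ∀ M : Ideal R, IsMaximalTIdeal K M →
      ∃ s ∉ M, x * algebraMap R K s ∈ (algebraMap R K).range) :
    x ∈ (algebraMap R K).range := by
  -- The denominator ideal of `x`. It lies in no maximal `t`-ideal, so it contains some `J` with
  -- trivial inverse, and `xJ ⊆ R`.
  let D : Ideal R :=
    { carrier := {r | x * algebraMap R K r ∈ (algebraMap R K).range}
      add_mem' := fun {a b} ha hb => by
        simp only [Set.mem_ofPred_eq, map_add, mul_add] at *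
        exact add_mem ha hb
      zero_mem' := by simp
      smul_mem' := fun c a ha => by
        simp only [Set.mem_ofPred_eq, smul_eq_mul, map_mul] at *
        rw [mul_left_comm]
        exact mul_mem ⟨c, rfl⟩ ha }
  have hD0 : D ≠ ⊥ := by
    obtain ⟨a, b, hb, rfl⟩ := IsFractionRing.div_surjective R x
    have hb0 := nonZeroDivisors.ne_zero hb
    have : algebraMap R K b ≠ 0 := by
      simpa using hb0
    intro h
    have : b ∈ D := ⟨a, by field_simp⟩
    exact hb0 (by simpa [h] using this)
  have hD : ¬ IsTProper K D := by
    intro hD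
    obtain ⟨M, hM, hDM⟩ := hD.exists_le_isMaximalTIdeal
    obtain ⟨s, hs, hxs⟩ := h M hM
    exact hs (hDM hxs)
  obtain ⟨J, hJD, -, -, hJ⟩ := exists_fg_of_not_isTProper hD0 hD
  exact hJ x fun j hj => hJD hj

/-! ### `t`-invertibility as local principality -/

/-- A `t`-invertible ideal is locally principal at a maximal `t`-ideal, generated by a member of
any given set of generators. -/
theorem IsTInvertible.exists_dvd {S : Set R} (hJ : IsTInvertible K (Ideal.span S))
    {M : Ideal R} (hM : IsMaximalTIdeal K M) :
    ∃ j ∈ S, ∃ s ∉ M, ∀ x ∈ Ideal.span S, j ∣ s * x := by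
  have inj : Function.Injective (algebraMap R K) := IsFractionRing.injective R K
  by_contra! hcon
  -- For a generator `j` and `u` in the inverse, `r = uj` satisfies `j ∣ r * x` for all `x` in the
  -- ideal; so `r ∉ M` would make `j` a local generator.
  have hle : ((Ideal.span S : Ideal R) : FractionalIdeal R⁰ K) *
      ((Ideal.span S : Ideal R) : FractionalIdeal R⁰ K)⁻¹ ≤ M := by
    rw [FractionalIdeal.mul_le]
    intro i hi u hu
    obtain ⟨i, hiS, rfl⟩ := (FractionalIdeal.mem_coeIdeal _).1 hi
    clear hi
    rw [mem_coeIdeal_inv_iff hJ.1] at hu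
    induction hiS using Submodule.span_induction with
    | mem j hj =>
      obtain ⟨r, hr⟩ := hu j (Ideal.subset_span hj)
      rw [mul_comm, ← hr]
      refine FractionalIdeal.mem_coeIdeal_of_mem _ ?_
      by_contra hrM
      obtain ⟨x, hx, hjx⟩ := hcon j hj r hrM
      obtain ⟨t, ht⟩ := hu x hx
      refine hjx ⟨t, inj ?_⟩
      rw [map_mul, map_mul, hr, ht]
      ring
    | zero => simp
    | add a b _ _ ha hb =>
      rw [map_add, add_mul]
      exact Submodule.add_mem (M : FractionalIdeal R⁰ K).coeToSubmodule ha hb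
    | smul c a _ ha =>
      rw [smul_eq_mul, map_mul, mul_assoc, ← Algebra.smul_def]
      exact Submodule.smul_mem (M : FractionalIdeal R⁰ K).coeToSubmodule c ha
  have h1 : (1 : K) ∈ tClosure (M : FractionalIdeal R⁰ K) :=
    tClosure_mono hle (by rw [hJ.2]; exact FractionalIdeal.one_mem_one R⁰)
  rw [hM.prop.2.2, FractionalIdeal.mem_coeIdeal] at h1
  obtain ⟨r, hr, hr1⟩ := h1
  rw [← map_one (algebraMap R K)] at hr1
  exact hM.prop.2.1 ((Ideal.eq_top_iff_one _).2 (inj hr1 ▸ hr))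

/-- Since `s / j ∈ J⁻¹`, the element `s ∉ M` lies in `J J⁻¹`; hence no maximal `t`-ideal contains `J
J⁻¹`. -/
theorem isTInvertible_of_forall_exists_dvd {J : Ideal R} (hJ : J ≠ ⊥)
    (h : ∀ M : Ideal R, IsMaximalTIdeal K M → ∃ j ∈ J, ∃ s ∉ M, ∀ x ∈ J, j ∣ s * x) :
    IsTInvertible K J := by
  have inj : Function.Injective (algebraMap R K) := IsFractionRing.injective R K
  refine ⟨hJ, ?_⟩
  obtain ⟨A, hA⟩ := FractionalIdeal.le_one_iff_exists_coeIdeal.1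
    (FractionalIdeal.mul_one_div_le_one (I := (J : FractionalIdeal R⁰ K)))
  rw [FractionalIdeal.inv_eq, ← hA]
  have hA0 : A ≠ ⊥ := by
    rintro rfl
    have h0 := FractionalIdeal.bot_lt_mul_inv (FractionalIdeal.coeIdeal_ne_zero (K := K).2 hJ)
    rw [FractionalIdeal.inv_eq, ← hA, FractionalIdeal.coeIdeal_bot] at h0
    exact lt_irrefl _ h0
  have hnot : ¬ IsTProper K A := by
    intro hAt
    obtain ⟨M, hM, hAM⟩ := hAt.exists_le_isMaximalTIdeal
    obtain ⟨j, hj, s, hs, hx⟩ := h M hM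
    have hj0 : algebraMap R K j ≠ 0 := by
      intro h0
      rw [map_eq_zero_iff _ inj] at h0
      subst h0
      obtain ⟨x, hxJ, hx0⟩ := Submodule.exists_mem_ne_zero_of_ne_bot hJ
      have := zero_dvd_iff.1 (hx x hxJ)
      rcases mul_eq_zero.1 this with rfl | h0
      · exact hs (zero_mem _)
      · exact hx0 h0
    have hsA : algebraMap R K s ∈ (A : FractionalIdeal R⁰ K) := by
      rw [hA, ← FractionalIdeal.inv_eq]
      have hmem : algebraMap R K s / algebraMap R K j ∈ (J : FractionalIdeal R⁰ K)⁻¹ := by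
        rw [mem_coeIdeal_inv_iff hJ]
        intro x hxJ
        obtain ⟨t, ht⟩ := hx x hxJ
        refine ⟨t, ?_⟩
        rw [div_mul_eq_mul_div, eq_div_iff hj0, ← map_mul, ← map_mul, ht, mul_comm]
      have := FractionalIdeal.mul_mem_mul (FractionalIdeal.mem_coeIdeal_of_mem R⁰ hj) hmem
      rwa [mul_div_cancel₀ _ hj0] at this
    obtain ⟨s', hs', hss⟩ := (FractionalIdeal.mem_coeIdeal _).1 hsA
    exact hs (hAM (inj hss ▸ hs'))
  obtain ⟨N, hNA, hN0, hN, hNt⟩ := exists_fg_of_not_isTProper hA0 hnot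
  refine le_antisymm ?_ ?_
  · intro x hx
    obtain ⟨L, -, -, -, hx⟩ := (mem_tClosure_coeIdeal_iff hA0).1 hx
    exact vClosure_coeIdeal_le_one L hx
  · rw [FractionalIdeal.one_le]
    exact (mem_tClosure_coeIdeal_iff hA0).2 ⟨N, hNA, hN0, hN, (one_mem_vClosure_iff hN0).2 hNt⟩

/-! ### Divisibility in the localization at a prime -/

/-- Divisibility of `b` by `a` in the localization of `R` at `M`. -/
def DvdAt (M : Ideal R) (a b : R) : Prop := ∃ s ∉ M, a ∣ s * b

section DvdAt

variable {M : Ideal R} [hM : M.IsPrime] {a b c : R}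

theorem DvdAt.of_dvd (h : a ∣ b) : DvdAt M a b :=
  ⟨1, M.one_notMem, h.mul_left 1⟩

theorem DvdAt.trans (h : DvdAt M a b) (h' : DvdAt M b c) : DvdAt M a c := by
  obtain ⟨s, hs, x, hx⟩ := h
  obtain ⟨t, ht, y, hy⟩ := h'
  exact ⟨s * t, hM.mul_notMem hs ht, x * y, by linear_combination s * hy + y * hx⟩

theorem DvdAt.mul_left (h : DvdAt M a b) (c : R) : DvdAt M (c * a) (c * b) := by
  obtain ⟨s, hs, x, hx⟩ := h
  exact ⟨s, hs, x, by linear_combination c * hx⟩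

theorem DvdAt.of_mul_left {s : R} (hs : s ∉ M) (h : DvdAt M a (s * b)) : DvdAt M a b := by
  obtain ⟨t, ht, h⟩ := h
  exact ⟨t * s, hM.mul_notMem ht hs, by rwa [mul_assoc]⟩

theorem DvdAt.mem_of_le {Q : Ideal R} [hQ : Q.IsPrime] (hQM : Q ≤ M) (h : DvdAt M a b)
    (ha : a ∈ Q) : b ∈ Q := by
  obtain ⟨s, hs, h⟩ := h
  exact (hQ.mem_or_mem (Q.mem_of_dvd h ha)).resolve_left fun h => hs (hQM h)

/-- In a localization where any two elements are comparable, finitely generated ideals are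
principal. -/
theorem exists_dvd_of_fg (h : ∀ a b : R, DvdAt M a b ∨ DvdAt M b a) {J : Ideal R} (hJ : J.FG) :
    ∃ j ∈ J, ∃ s ∉ M, ∀ x ∈ J, j ∣ s * x := by
  induction J, hJ using Submodule.fg_induction with
  | singleton x =>
    refine ⟨x, Ideal.mem_span_singleton_self x, 1, M.one_notMem, fun y hy => ?_⟩
    exact (Ideal.mem_span_singleton.1 hy).mul_left 1
  | sup I J hI hJ ihI ihJ =>
    obtain ⟨i, hi, s, hs, hsi⟩ := ihI
    obtain ⟨j, hj, t, ht, htj⟩ := ihJ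
    rcases h i j with ⟨r, hr, y, hy⟩ | ⟨r, hr, y, hy⟩
    · refine ⟨i, Ideal.mem_sup_left hi, r * (s * t), hM.mul_notMem hr (hM.mul_notMem hs ht),
        fun z hz => ?_⟩
      obtain ⟨x, hx, w, hw, rfl⟩ := Submodule.mem_sup.1 hz
      obtain ⟨p, hp⟩ := hsi x hx
      obtain ⟨q, hq⟩ := htj w hw
      exact ⟨r * t * p + s * y * q,
        by linear_combination r * t * hp + r * s * hq + s * q * hy⟩
    · refine ⟨j, Ideal.mem_sup_right hj, r * (s * t), hM.mul_notMem hr (hM.mul_notMem hs ht),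
        fun z hz => ?_⟩
      obtain ⟨x, hx, w, hw, rfl⟩ := Submodule.mem_sup.1 hz
      obtain ⟨p, hp⟩ := hsi x hx
      obtain ⟨q, hq⟩ := htj w hw
      exact ⟨r * s * q + t * y * p,
        by linear_combination r * t * hp + r * s * hq + t * p * hy⟩

theorem eq_of_le_of_height_eq_one {Q : Ideal R} [Q.IsPrime] (hM1 : M.height = 1) (hQ : Q ≠ ⊥)
    (h : Q ≤ M) : Q = M := by
  by_contra hne
  have := Ideal.height_add_one_le_of_lt_of_isPrime (lt_of_le_of_ne h hne)
  rw [hM1] at this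
  have : Q.height + 1 ≤ 0 + 1 := by simpa using this
  have h0 : Q.height = 0 :=
    le_antisymm ((ENat.add_le_add_iff_right ENat.one_ne_top).1 this) bot_le
  exact hQ (Ideal.height_eq_zero_iff_eq_bot.1 h0)

/-- Otherwise a prime containing `a` avoids the products of powers of `m` with elements outside `M`:
it is nonzero, lies in `M` and misses `m`. -/
theorem dvdAt_pow_of_height_eq_one (hM1 : M.height = 1) {m : R} (ha : a ≠ 0) (hm : m ∈ M) :
    ∃ n : ℕ, DvdAt M a (m ^ n) := by
  by_contra! hcon
  obtain ⟨Q, hQ, haQ, hdisj⟩ := Ideal.exists_le_prime_disjoint (Ideal.span {a})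
    (M.primeCompl ⊔ Submonoid.powers m) (by
      rw [Set.disjoint_left]
      intro x hx hx'
      obtain ⟨s, hs, t, ⟨n, rfl⟩, rfl⟩ := Submonoid.mem_sup.1 hx'
      exact hcon n ⟨s, hs, Ideal.mem_span_singleton.1 hx⟩)
  rw [Set.disjoint_left] at hdisj
  have hQM : Q ≤ M := fun x hx => by
    by_contra hxM
    exact hdisj hx ((le_sup_left : M.primeCompl ≤ _) hxM)
  have hmQ : m ∉ Q := fun h =>
    hdisj h ((le_sup_right : Submonoid.powers m ≤ _) (Submonoid.mem_powers m))
  have hQ0 : Q ≠ ⊥ := fun h => ha <| by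
    simpa [h] using haQ (Ideal.mem_span_singleton_self a)
  exact hmQ (eq_of_le_of_height_eq_one hM1 hQ0 hQM ▸ hm)

/-- Some power `c ^ n` is divisible by `a`; if `c ^ (n + 1)` divided `a`, then `c` would be a unit
at `M`. -/
theorem not_pow_dvdAt_of_height_eq_one (hM1 : M.height = 1) (ha : a ≠ 0) (hc : c ∈ M)
    (hc0 : c ≠ 0) : ∃ n : ℕ, ¬ DvdAt M (c ^ n) a := by
  obtain ⟨n, hn⟩ := dvdAt_pow_of_height_eq_one hM1 ha hc
  refine ⟨n + 1, fun h => ?_⟩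
  obtain ⟨s, hs, y, hy⟩ := h.trans hn
  refine hs ?_
  have : s = c * y := mul_right_cancel₀ (pow_ne_zero n hc0) (by rw [hy]; ring)
  exact this ▸ M.mul_mem_right y hc

theorem height_eq_one_of_forall (h0 : M ≠ ⊥)
    (h : ∀ Q : Ideal R, Q.IsPrime → Q ≠ ⊥ → Q ≤ M → M ≤ Q) : M.height = 1 := by
  refine le_antisymm ?_ ?_
  · exact_mod_cast Ideal.height_le_iff (n := 1).2 fun Q hQ hQM => by
      have : Q = ⊥ := by
        by_contra hQ0
        exact hQM.not_ge (h Q hQ hQ0 hQM.le)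
      rw [Ideal.height_eq_zero_iff_eq_bot.2 this]
      simp
  · rw [Order.one_le_iff_ne_zero, Ne, Ideal.height_eq_zero_iff_eq_bot]
    exact h0

/-- Suppose that any two elements are comparable at `M` unless `c` divides both. Then any two
elements are comparable as soon as no nonzero element is divisible by all powers of `c`. -/
theorem dvdAt_total_of_pow
    (h : ∀ x y : R, DvdAt M x y ∨ DvdAt M y x ∨ DvdAt M c x ∧ DvdAt M c y)
    (harch : ∀ a : R, a ≠ 0 → ∃ n : ℕ, ¬ DvdAt M (c ^ n) a) (a b : R) :
    DvdAt M a b ∨ DvdAt M b a := by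
  -- Cancelling `c` from both elements lowers the bound on the powers of `c` dividing `x`.
  have key : ∀ (n : ℕ) (x y : R), ¬ DvdAt M (c ^ n) x → DvdAt M x y ∨ DvdAt M y x := by
    intro n
    induction n with
    | zero => exact fun x y hx => absurd (DvdAt.of_dvd (by simp)) hx
    | succ n ih =>
      intro x y hx
      rcases h x y with h | h | ⟨⟨s, hs, x', hx'⟩, ⟨t, ht, y', hy'⟩⟩
      · exact .inl h
      · exact .inr h
      · have hn : ¬ DvdAt M (c ^ n) x' := fun h' => hx <| by
          have := h'.mul_left c
          rw [← pow_succ', ← hx'] at this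
          exact this.of_mul_left hs
        refine (ih x' y' hn).imp (fun h' => ?_) fun h' => ?_
        · have := h'.mul_left c
          rw [← hx', ← hy'] at this
          exact (DvdAt.of_dvd (Dvd.intro_left s rfl)).trans (this.of_mul_left ht)
        · have := h'.mul_left c
          rw [← hx', ← hy'] at this
          exact (DvdAt.of_dvd (Dvd.intro_left t rfl)).trans (this.of_mul_left hs)
  by_cases ha : a = 0
  · exact .inr (DvdAt.of_dvd (ha ▸ dvd_zero b))
  · obtain ⟨n, hn⟩ := harch a ha
    exact key n a b hn

/-- Factors `c` can be split off `q` fewer than `n` times; the cofactor left over then divides `c`.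
-/
theorem exists_dvdAt_pow (h : ∀ x : R, DvdAt M c x ∨ DvdAt M x c) (n : ℕ) {q : R}
    (hq : ¬ DvdAt M (c ^ n) q) : ∃ k : ℕ, DvdAt M q (c ^ k) := by
  induction n generalizing q with
  | zero => exact absurd (DvdAt.of_dvd (by simp)) hq
  | succ n ih =>
    rcases h q with ⟨s, hs, q', hq'⟩ | h
    · have hn : ¬ DvdAt M (c ^ n) q' := fun h' => hq <| by
        have := h'.mul_left c
        rw [← pow_succ', ← hq'] at this
        exact this.of_mul_left hs
      obtain ⟨k, hk⟩ := ih hn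
      have := hk.mul_left c
      rw [← hq', ← pow_succ'] at this
      exact ⟨k + 1, (DvdAt.of_dvd (Dvd.intro_left s rfl)).trans this⟩
    · exact ⟨1, by simpa using h⟩

end DvdAt

/-! ### The definitions in terms of elements -/

theorem mem_localizationAt_iff {P : PrimeSpectrum R} {x : K} :
    x ∈ localizationAt K P ↔
      ∃ s ∉ P.asIdeal, x * algebraMap R K s ∈ (algebraMap R K).range := by
  have inj : Function.Injective (algebraMap R K) := IsFractionRing.injective R K
  have hne : ∀ s ∉ P.asIdeal, algebraMap R K s ≠ 0 := fun s hs h =>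
    hs ((map_eq_zero_iff _ inj).1 h ▸ zero_mem _)
  change (∃ (a s : R) (_ : s ∈ P.asIdeal.primeCompl),
    x = algebraMap R K a * (algebraMap R K s)⁻¹) ↔ _
  constructor
  · rintro ⟨a, s, hs, rfl⟩
    exact ⟨s, hs, a, by rw [inv_mul_cancel_right₀ (hne s hs)]⟩
  · rintro ⟨s, hs, a, ha⟩
    exact ⟨a, s, hs, by rw [ha, mul_inv_cancel_right₀ (hne s hs)]⟩

theorem isEssentialPrime_iff {P : PrimeSpectrum R} :
    IsEssentialPrime K P ↔ ∀ a b : R, DvdAt P.asIdeal a b ∨ DvdAt P.asIdeal b a := by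
  have inj : Function.Injective (algebraMap R K) := IsFractionRing.injective R K
  have hne : ∀ s ∉ P.asIdeal, algebraMap R K s ≠ 0 := fun s hs h =>
    hs ((map_eq_zero_iff _ inj).1 h ▸ zero_mem _)
  constructor
  · intro (h : ValuationRing (localizationAt K P)) a b
    have aux : ∀ (a b : R) (c : localizationAt K P),
        algebraMap R (localizationAt K P) a * c = algebraMap R (localizationAt K P) b →
        DvdAt P.asIdeal a b := by
      intro a b c hc
      obtain ⟨s, hs, r, hr⟩ := mem_localizationAt_iff.1 c.2
      have hc' : algebraMap R K a * c = algebraMap R K b := congrArg Subtype.val hc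
      refine ⟨s, hs, r, inj ?_⟩
      rw [map_mul, map_mul, hr, ← hc']
      ring
    obtain ⟨c, hc | hc⟩ := ValuationRing.cond (algebraMap R (localizationAt K P) a)
      (algebraMap R (localizationAt K P) b)
    · exact .inl (aux _ _ c hc)
    · exact .inr (aux _ _ c hc)
  · intro h
    have aux : ∀ x y : localizationAt K P, ∀ (a b s t : R), s ∉ P.asIdeal → t ∉ P.asIdeal →
        algebraMap R K a = x * algebraMap R K s → algebraMap R K b = y * algebraMap R K t →
        DvdAt P.asIdeal a b → ∃ c, x * c = y := by
      rintro x y a b s t hs ht hx hy ⟨r, hr, d, hd⟩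
      have hs0 := hne s hs
      have ht0 := hne t ht
      have hr0 := hne r hr
      have hd' := congrArg (algebraMap R K) hd
      simp only [map_mul, hx, hy] at hd'
      refine ⟨⟨algebraMap R K (s * d) / algebraMap R K (r * t), mem_localizationAt_iff.2
        ⟨r * t, P.isPrime.mul_notMem hr ht, s * d, ?_⟩⟩, Subtype.ext ?_⟩
      · rw [div_mul_cancel₀]
        exact hne _ (P.isPrime.mul_notMem hr ht)
      · change (x : K) * (algebraMap R K (s * d) / algebraMap R K (r * t)) = y
        rw [map_mul, map_mul, mul_div_assoc', div_eq_iff (mul_ne_zero hr0 ht0)]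
        linear_combination -hd'
    refine { cond' := fun x y => ?_ }
    obtain ⟨s, hs, a, ha⟩ := mem_localizationAt_iff.1 x.2
    obtain ⟨t, ht, b, hb⟩ := mem_localizationAt_iff.1 y.2
    rcases h a b with h | h
    · exact (aux x y a b s t hs ht ha hb h).imp fun _ => .inl
    · exact (aux y x b a t s ht hs hb ha h).imp fun _ => .inr

theorem isDefiningFamily_iff {F : Set (PrimeSpectrum R)} :
    IsDefiningFamily K F ↔ ∀ x : K, (∀ P ∈ F, ∃ s ∉ P.asIdeal,
      x * algebraMap R K s ∈ (algebraMap R K).range) → x ∈ (algebraMap R K).range := by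
  rw [IsDefiningFamily, ← le_bot_iff, SetLike.le_def]
  simp only [Algebra.mem_iInf, mem_localizationAt_iff, Algebra.mem_bot, RingHom.mem_range,
    Set.mem_range]

theorem isCompletelyIntegrallyClosed_iff :
    IsCompletelyIntegrallyClosed R K ↔ ∀ (u : K) (a : R), a ≠ 0 →
      (∀ n : ℕ, algebraMap R K a * u ^ n ∈ (algebraMap R K).range) →
        u ∈ (algebraMap R K).range := by
  rw [IsCompletelyIntegrallyClosed, ← le_bot_iff, SetLike.le_def]
  simp only [mem_completeIntegralClosure, IsAlmostIntegral, Algebra.mem_bot, RingHom.mem_range,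
    Set.mem_range, mem_nonZeroDivisors_iff_ne_zero, Algebra.smul_def]
  exact ⟨fun h u a ha hu => h ⟨a, ha, hu⟩, fun h u ⟨a, ha, hu⟩ => h u a ha hu⟩

/-! ### Essential primes and generalized Krull domains -/

/-- A finitely generated `J ⊆ P` has a local generator `j`, so `s / j ∈ J⁻¹` for some `s ∉ P`; if `s
/ j` were in `R`, then `s ∈ jR ⊆ P`. -/
theorem isTProper_of_dvdAt_total {P : Ideal R} [P.IsPrime] (h0 : P ≠ ⊥)
    (h : ∀ a b : R, DvdAt P a b ∨ DvdAt P b a) : IsTProper K P := by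
  by_contra hP
  obtain ⟨J, hJP, hJ0, hJ, hJt⟩ := exists_fg_of_not_isTProper h0 hP
  have inj : Function.Injective (algebraMap R K) := IsFractionRing.injective R K
  obtain ⟨j, hj, s, hs, hsj⟩ := exists_dvd_of_fg h hJ
  have hj0 : algebraMap R K j ≠ 0 := by
    rw [Ne, map_eq_zero_iff _ inj]
    rintro rfl
    obtain ⟨x, hxJ, hx0⟩ := Submodule.exists_mem_ne_zero_of_ne_bot hJ0
    rcases mul_eq_zero.1 (zero_dvd_iff.1 (hsj x hxJ)) with rfl | h0
    · exact hs (zero_mem _)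
    · exact hx0 h0
  obtain ⟨r, hr⟩ := hJt (algebraMap R K s / algebraMap R K j) fun x hx => by
    obtain ⟨t, ht⟩ := hsj x hx
    exact ⟨t, by rw [div_mul_eq_mul_div, eq_div_iff hj0, ← map_mul, ← map_mul, ht, mul_comm]⟩
  rw [eq_div_iff hj0, ← map_mul] at hr
  exact hs (inj hr ▸ P.mul_mem_left r (hJP hj))

theorem IsDefiningFamily.hasTrivialInverse {F : Set (PrimeSpectrum R)}
    (hF : IsDefiningFamily K F) {J : Ideal R} (hJ : ∀ P ∈ F, ¬ J ≤ P.asIdeal) :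
    HasTrivialInverse K J := by
  intro u hu
  refine isDefiningFamily_iff.1 hF u fun P hP => ?_
  obtain ⟨j, hj, hjP⟩ := SetLike.not_le_iff_exists.1 (hJ P hP)
  exact ⟨j, hjP, hu j hj⟩

/-- An ideal avoids any finite set of primes not containing it. -/
theorem exists_mem_forall_notMem {I : Ideal R} {S : Set (PrimeSpectrum R)} (hS : S.Finite)
    (h : ∀ P ∈ S, ¬ I ≤ P.asIdeal) : ∃ b ∈ I, ∀ P ∈ S, b ∉ P.asIdeal := by
  by_contra! hcon
  -- Prime avoidance permits two exceptional indices; the zero prime is a dummy value for both.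
  obtain ⟨P, hP, hIP⟩ := (Ideal.subset_union_prime (R := R) (s := hS.toFinset)
    (f := PrimeSpectrum.asIdeal) (I := I) ⟨⊥, Ideal.isPrime_bot⟩ ⟨⊥, Ideal.isPrime_bot⟩
    fun P _ _ _ => P.isPrime).1 fun b hb => by simpa using hcon b hb
  exact h P (hS.mem_toFinset.1 hP) hIP

/-- Members of `F` satisfy `IsTProper`, so one containing `M` equals `M`. If none does, choose `b ∈
M` outside the finitely many members containing `a`: then `(a, b)` lies in no member and has trivial
inverse. -/
theorem exists_eq_of_isMaximalTIdeal {F : Set (PrimeSpectrum R)} (hF : IsDefiningFamily K F)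
    (hfin : HasFiniteCharacter F)
    (hP : ∀ P ∈ F, P.asIdeal.height = 1 ∧ IsEssentialPrime K P) {M : Ideal R}
    (hM : IsMaximalTIdeal K M) : ∃ P ∈ F, P.asIdeal = M := by
  obtain ⟨a, ha, ha0⟩ := Submodule.exists_mem_ne_zero_of_ne_bot hM.prop.1
  by_contra! hcon
  have hM' := isMaximalTIdeal_iff.1 hM
  obtain ⟨b, hb, hbP⟩ := exists_mem_forall_notMem (I := M) (hfin a ha0) fun P hPF hMP =>
    hcon P hPF.1 (hM'.eq_of_le (isTProper_of_dvdAt_total (Ideal.ne_bot_of_height_eq_one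
      (hP P hPF.1).1) (isEssentialPrime_iff.1 (hP P hPF.1).2)) hMP).symm
  refine hM.isTProper.2 (Ideal.span {a, b}) ?_ (Submodule.fg_span (Set.toFinite _))
    (hF.hasTrivialInverse fun P hPF hle => ?_)
  · rw [Ideal.span_le]
    rintro x (rfl | rfl)
    · exact ha
    · exact hb
  · exact hbP P ⟨hPF, hle (Ideal.subset_span (by simp))⟩ (hle (Ideal.subset_span (by simp)))

/-- Choosing `b ∈ M` outside the members other than `M` that contain `a` leaves `M` as the only
maximal `t`-ideal over `(a, b)`. -/
theorem IsGeneralizedKrullDomain.isTPotent (h : IsGeneralizedKrullDomain R K) :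
    IsTPotent R K := by
  obtain ⟨F, hF, hfin, hP⟩ := h
  intro M hM
  have hM' := isMaximalTIdeal_iff.1 hM
  obtain ⟨a, ha, ha0⟩ := Submodule.exists_mem_ne_zero_of_ne_bot hM.prop.1
  obtain ⟨b, hb, hbP⟩ := exists_mem_forall_notMem (I := M)
    (S := {P ∈ F | a ∈ P.asIdeal} ∩ {P | P.asIdeal ≠ M}) ((hfin a ha0).inter_of_left _)
    fun P hPF hMP => hPF.2 (hM'.eq_of_le (isTProper_of_dvdAt_total (Ideal.ne_bot_of_height_eq_one
      (hP P hPF.1.1).1) (isEssentialPrime_iff.1 (hP P hPF.1.1).2)) hMP).symm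
  have hle : Ideal.span {a, b} ≤ M := by
    rw [Ideal.span_le]
    rintro x (rfl | rfl)
    · exact ha
    · exact hb
  refine ⟨Ideal.span {a, b}, ⟨fun h => ha0 ?_, Submodule.fg_span (Set.toFinite _), M, ⟨hM, hle⟩,
    ?_⟩, hle⟩
  · have : a ∈ Ideal.span {a, b} := Ideal.subset_span (by simp)
    simpa [h] using this
  · rintro N ⟨hN, hNle⟩
    obtain ⟨P, hPF, rfl⟩ := exists_eq_of_isMaximalTIdeal hF hfin hP hN
    by_contra hne
    exact hbP P ⟨⟨hPF, hNle (Ideal.subset_span (by simp))⟩, hne⟩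
      (hNle (Ideal.subset_span (by simp)))

theorem IsGeneralizedKrullDomain.isEssentialDomain (h : IsGeneralizedKrullDomain R K) :
    IsEssentialDomain R K := by
  obtain ⟨F, hF, -, hP⟩ := h
  exact ⟨F, hF, fun P hPF => (hP P hPF).2⟩

theorem IsGeneralizedKrullDomain.hasTDimensionOne (h : IsGeneralizedKrullDomain R K) :
    HasTDimensionOne R K := by
  obtain ⟨F, hF, hfin, hP⟩ := h
  intro M hM
  obtain ⟨P, hPF, rfl⟩ := exists_eq_of_isMaximalTIdeal hF hfin hP hM
  exact (hP P hPF).1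

/-- A `t`-rigid `I ⊆ M` has nontrivial inverse, so it lies in some `P ∈ F`. A maximal `t`-ideal over
`P` contains `I`, hence is `M`, and height one gives `P = M`. -/
theorem IsEssentialDomain.isPvMD (h : IsEssentialDomain R K) (hpot : IsTPotent R K)
    (hdim : HasTDimensionOne R K) : IsPvMD R K := by
  obtain ⟨F, hF, hP⟩ := h
  intro J hJ0 hJ
  refine isTInvertible_of_forall_exists_dvd hJ0 fun M hM => ?_
  have := hM.isPrime
  refine exists_dvd_of_fg ?_ hJ
  obtain ⟨I, ⟨hI0, hI, N, -, hN⟩, hIM⟩ := hpot M hM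
  have hI' : ∃ P ∈ F, I ≤ P.asIdeal := by
    by_contra! hcon
    exact hM.isTProper.2 I hIM hI (hF.hasTrivialInverse hcon)
  obtain ⟨P, hPF, hIP⟩ := hI'
  have hP0 : P.asIdeal ≠ ⊥ := fun h => hI0 (le_bot_iff.1 (h ▸ hIP))
  have htot := isEssentialPrime_iff.1 (hP P hPF)
  obtain ⟨L, hL, hPL⟩ :=
    (isTProper_of_dvdAt_total (K := K) hP0 htot).exists_le_isMaximalTIdeal
  have := hL.isPrime
  have hPM : P.asIdeal = M := by
    rw [eq_of_le_of_height_eq_one (hdim L hL) hP0 hPL, hN L ⟨hL, hIP.trans hPL⟩, hN M ⟨hM, hIM⟩]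
  exact hPM ▸ htot

theorem IsPvMD.isTSuperPotent (h : IsPvMD R K) (hpot : IsTPotent R K) : IsTSuperPotent R K := by
  intro M hM
  obtain ⟨I, hI, hIM⟩ := hpot M hM
  exact ⟨I, ⟨hI, fun J hJ hIJ => h J (fun h0 => hI.1 (le_bot_iff.1 (h0 ▸ hIJ))) hJ⟩, hIM⟩

theorem IsTSuperPotent.isTPotent (h : IsTSuperPotent R K) : IsTPotent R K := by
  intro M hM
  obtain ⟨I, hI, hIM⟩ := h M hM
  exact ⟨I, hI.1, hIM⟩

/-! ### Local structure at a `t`-super rigid ideal -/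

/-- A `t`-super rigid ideal contained in `M` is principal at `M`, and any two elements of `R` are
comparable at `M` unless a generator divides both. -/
theorem IsTSuperRigid.exists_generator {I : Ideal R} (hI : IsTSuperRigid K I) {M : Ideal R}
    (hM : IsMaximalTIdeal K M) : ∃ c ∈ I, c ≠ 0 ∧ (∃ s ∉ M, ∀ x ∈ I, c ∣ s * x) ∧
      ∀ x y : R, DvdAt M x y ∨ DvdAt M y x ∨ DvdAt M c x ∧ DvdAt M c y := by
  have := hM.isPrime
  have hII : IsTInvertible K (Ideal.span (I : Set R)) := by
    rw [Ideal.span_eq]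
    exact hI.2 I hI.1.2.1 le_rfl
  obtain ⟨c, hc, s, hs, hcs⟩ := hII.exists_dvd hM
  rw [Ideal.span_eq] at hcs
  refine ⟨c, hc, ?_, ⟨s, hs, hcs⟩, fun x y => ?_⟩
  · rintro rfl
    obtain ⟨x, hxI, hx0⟩ := Submodule.exists_mem_ne_zero_of_ne_bot hI.1.1
    rcases mul_eq_zero.1 (zero_dvd_iff.1 (hcs x hxI)) with rfl | h0
    · exact hs (zero_mem _)
    · exact hx0 h0
  -- With `I ∪ {x, y}` as generating set, the local generator of `I + (x, y)` is `x`, `y` or an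
  -- element of `I`, the last being divisible by `c` at `M`.
  · have heq : Ideal.span ((I : Set R) ∪ {x, y}) = I ⊔ Ideal.span {x, y} := by
      rw [Ideal.span_union, Ideal.span_eq]
    have hJ := hI.2 (I ⊔ Ideal.span {x, y})
      (Submodule.FG.sup hI.1.2.1 (Submodule.fg_span (Set.toFinite _))) le_sup_left
    rw [← heq] at hJ
    obtain ⟨j, hj, t, ht, hjt⟩ := hJ.exists_dvd hM
    have hx : DvdAt M j x := ⟨t, ht, hjt x (Ideal.subset_span (by simp))⟩
    have hy : DvdAt M j y := ⟨t, ht, hjt y (Ideal.subset_span (by simp))⟩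
    rcases hj with hj | rfl | rfl
    · have hcj : DvdAt M c j := ⟨s, hs, hcs j hj⟩
      exact .inr (.inr ⟨hcj.trans hx, hcj.trans hy⟩)
    · exact .inl hy
    · exact .inr (.inl hx)

theorem IsTSuperPotent.dvdAt_total (h : IsTSuperPotent R K) (hdim : HasTDimensionOne R K)
    {M : Ideal R} (hM : IsMaximalTIdeal K M) (a b : R) : DvdAt M a b ∨ DvdAt M b a := by
  have := hM.isPrime
  obtain ⟨I, hI, hIM⟩ := h M hM
  obtain ⟨c, hcI, hc0, -, hc⟩ := hI.exists_generator hM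
  exact dvdAt_total_of_pow hc
    (fun a ha => not_pow_dvdAt_of_height_eq_one (hdim M hM) ha (hIM hcI) hc0) a b

/-! ### Finite character -/

/-- A power of a finitely generated subideal of a prime `M` of height one lies in `aR_M`. -/
theorem exists_forall_mem_pow_dvd {M : Ideal R} [M.IsPrime] (hM1 : M.height = 1) {I : Ideal R}
    (hI : I.FG) (hIM : I ≤ M) {a : R} (ha : a ≠ 0) :
    ∃ n : ℕ, ∃ s ∉ M, ∀ x ∈ I ^ n, a ∣ s * x := by
  induction I, hI using Submodule.fg_induction with
  | singleton x =>
    obtain ⟨n, s, hs, hn⟩ := dvdAt_pow_of_height_eq_one hM1 ha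
      (hIM (Ideal.mem_span_singleton_self x))
    refine ⟨n, s, hs, fun y hy => ?_⟩
    change y ∈ Ideal.span {x} ^ n at hy
    rw [Ideal.span_singleton_pow, Ideal.mem_span_singleton] at hy
    exact hn.trans (mul_dvd_mul_left s hy)
  | sup I J hI hJ ihI ihJ =>
    obtain ⟨n, s, hs, hn⟩ := ihI (le_sup_left.trans hIM)
    obtain ⟨m, t, ht, hm⟩ := ihJ (le_sup_right.trans hIM)
    refine ⟨n + m, s * t, ‹M.IsPrime›.mul_notMem hs ht, fun x hx => ?_⟩
    obtain ⟨y, hy, z, hz, rfl⟩ := Submodule.mem_sup.1 (Ideal.sup_pow_add_le_pow_sup_pow hx)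
    obtain ⟨p, hp⟩ := hn y hy
    obtain ⟨q, hq⟩ := hm z hz
    exact ⟨t * p + s * q, by linear_combination t * hp + s * hq⟩

/-- For a rigid `I ⊆ M` with `I ^ n ⊆ aR_M`, the ideal `B = (aR : I ^ n)` contains `a`, is not
inside `M`, and is inside every other maximal `t`-ideal over `a`. The sum of all the `B` lies in no
maximal `t`-ideal, so finitely many already contain an ideal with trivial inverse; a maximal
`t`-ideal over `a` not indexed by these would contain it. -/
theorem IsTPotent.finite_setOf_mem (h : IsTPotent R K) (hdim : HasTDimensionOne R K) {a : R}
    (ha : a ≠ 0) : {M : Ideal R | IsMaximalTIdeal K M ∧ a ∈ M}.Finite := by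
  let S := {M : Ideal R | IsMaximalTIdeal K M ∧ a ∈ M}
  have key : ∀ M : S, ∃ B : Ideal R, a ∈ B ∧ ¬ B ≤ M ∧ ∀ N ∈ S, N ≠ M → B ≤ N := by
    rintro ⟨M, hM, haM⟩
    have := hM.isPrime
    obtain ⟨I, ⟨hI0, hI, L, -, hL⟩, hIM⟩ := h M hM
    obtain ⟨n, s, hs, hn⟩ := exists_forall_mem_pow_dvd (hdim M hM) hI hIM ha
    refine ⟨(Ideal.span {a}).colon (I ^ n : Ideal R), ?_, fun hle => hs (hle ?_), ?_⟩
    · exact Submodule.mem_colon.2 fun x _ => Ideal.mem_span_singleton.2 (Dvd.intro x rfl)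
    · exact Submodule.mem_colon.2 fun x hx => Ideal.mem_span_singleton.2 (hn x hx)
    · rintro N ⟨hN, haN⟩ hNM b hb
      have := hN.isPrime
      have hIN : ¬ I ≤ N := fun hle => hNM ((hL N ⟨hN, hle⟩).trans (hL M ⟨hM, hIM⟩).symm)
      obtain ⟨i, hi, hiN⟩ := SetLike.not_le_iff_exists.1 hIN
      have hbi : b * i ^ n ∈ N := (Ideal.span_singleton_le_iff_mem N).2 haN
        (Submodule.mem_colon.1 hb _ (Ideal.pow_mem_pow hi n))
      exact (‹N.IsPrime›.mem_or_mem hbi).resolve_right fun h =>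
        hiN (‹N.IsPrime›.mem_of_pow_mem n h)
  choose B haB hBM hBN using key
  by_cases hne : Nonempty S
  swap
  · rw [not_nonempty_iff, Set.isEmpty_coe_sort] at hne
    exact (congrArg Set.Finite hne).mpr Set.finite_empty
  have haS : a ∈ ⨆ M, B M := (le_iSup B hne.some) (haB _)
  have h0 : ⨆ M, B M ≠ ⊥ := fun h0 => ha (by simpa [h0] using haS)
  have hnot : ¬ IsTProper K (⨆ M, B M) := by
    intro hp
    obtain ⟨M, hM, hle⟩ := hp.exists_le_isMaximalTIdeal
    exact hBM ⟨M, hM, hle haS⟩ ((le_iSup B _).trans hle)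
  obtain ⟨J, hJB, -, hJ, hJt⟩ := exists_fg_of_not_isTProper h0 hnot
  obtain ⟨T, hT⟩ :=
    CompleteLattice.IsCompactElement.exists_finset_of_le_iSup (Submodule R R)
      ((Submodule.fg_iff_compact J).1 hJ) B hJB
  refine (T.finite_toSet.image Subtype.val).subset fun M hM => ?_
  by_contra hMT
  refine hM.1.isTProper.2 J (hT.trans (iSup₂_le fun N hN => hBN N M hM ?_)) hJ hJt
  rintro rfl
  exact hMT ⟨N, hN, rfl⟩

theorem IsTSuperPotent.isGeneralizedKrullDomain (h : IsTSuperPotent R K)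
    (hdim : HasTDimensionOne R K) : IsGeneralizedKrullDomain R K := by
  refine ⟨{P | IsMaximalTIdeal K P.asIdeal}, ?_, fun a ha => ?_, fun P hP =>
    ⟨hdim _ hP, isEssentialPrime_iff.2 (h.dvdAt_total hdim hP)⟩⟩
  · exact isDefiningFamily_iff.2 fun x hx => mem_range_of_forall_isMaximalTIdeal fun M hM =>
      hx ⟨M, hM.isPrime⟩ hM
  · exact (h.isTPotent.finite_setOf_mem hdim ha).preimage
      (f := PrimeSpectrum.asIdeal) fun P _ Q _ => PrimeSpectrum.ext

/-! ### Complete integral closure and height one -/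

/-- Unless `u ∈ R_M`, its inverse lies in `M R_M`; height one then gives `u⁻ⁿ ∈ aR_M`, so `u = u ^
(n + 1) * u⁻ⁿ` lies in `a u ^ (n + 1) R_M ⊆ R_M`. -/
theorem IsTSuperPotent.isCompletelyIntegrallyClosed (h : IsTSuperPotent R K)
    (hdim : HasTDimensionOne R K) : IsCompletelyIntegrallyClosed R K := by
  have inj : Function.Injective (algebraMap R K) := IsFractionRing.injective R K
  rw [isCompletelyIntegrallyClosed_iff]
  intro u a ha hu
  refine mem_range_of_forall_isMaximalTIdeal fun M hM => ?_
  have := hM.isPrime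
  obtain ⟨x, y, hy, rfl⟩ := IsFractionRing.div_surjective R u
  have hy0 : algebraMap R K y ≠ 0 := by simpa using nonZeroDivisors.ne_zero hy
  have of_dvdAt : DvdAt M y x →
      ∃ s ∉ M, algebraMap R K x / algebraMap R K y * algebraMap R K s ∈ (algebraMap R K).range := by
    rintro ⟨s, hs, r, hr⟩
    refine ⟨s, hs, r, ?_⟩
    rw [div_mul_eq_mul_div, eq_div_iff hy0, ← map_mul, ← map_mul, mul_comm x, hr, mul_comm]
  rcases h.dvdAt_total hdim hM y x with h | ⟨t, ht, d, hd⟩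
  · exact of_dvdAt h
  by_cases hdM : d ∈ M
  · obtain ⟨n, s, hs, e, he⟩ := dvdAt_pow_of_height_eq_one (hdim M hM) ha hdM
    obtain ⟨p, hp⟩ := hu (n + 1)
    -- `s u = (a u ^ (n + 1)) e / t ^ n` since `d = t / u`
    refine ⟨s * t ^ n * t, ‹M.IsPrime›.mul_notMem (‹M.IsPrime›.mul_notMem hs
      fun h => ht (‹M.IsPrime›.mem_of_pow_mem n h)) ht, p * e * t, ?_⟩
    have hd' := congrArg (algebraMap R K) hd
    have he' := congrArg (algebraMap R K) he
    simp only [map_mul, map_pow] at hd' he' ⊢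
    set u := algebraMap R K x / algebraMap R K y with hu'
    have hx : algebraMap R K x = u * algebraMap R K y := by rw [hu', div_mul_cancel₀ _ hy0]
    have htu : algebraMap R K t = u * algebraMap R K d := by
      apply mul_right_cancel₀ hy0
      rw [hd', hx]
      ring
    have hpow : algebraMap R K t ^ n = u ^ n * algebraMap R K d ^ n := by rw [htu, mul_pow]
    rw [hp, hpow]
    linear_combination (-u ^ (n + 1) * algebraMap R K t) * he'
  · exact of_dvdAt ⟨d, hdM, t, by rw [mul_comm d, ← hd, mul_comm]⟩

/-- In a completely integrally closed domain, the powers of a `t`-super rigid ideal have no nonzero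
element in common at the maximal `t`-ideal containing it. -/
theorem IsCompletelyIntegrallyClosed.not_pow_dvdAt (h : IsCompletelyIntegrallyClosed R K)
    {I : Ideal R} (hI : IsTRigid K I) {M : Ideal R} (hM : IsMaximalTIdeal K M) (hIM : I ≤ M)
    {c : R} (hc : c ∈ I) {a : R} (ha : a ≠ 0) : ∃ n : ℕ, ¬ DvdAt M (c ^ n) a := by
  by_contra! hcon
  obtain ⟨hI0, hIfg, L, -, hL⟩ := hI
  -- For `u ∈ I⁻¹`, every `a u ^ n` lies in all `R_N`: at `M` because `c ^ n` divides `a` and `uc ∈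
  -- R`, elsewhere because an element of `I` outside `N` clears denominators. So `u ∈ R`, and `I⁻¹ ⊆
  -- R` is absurd.
  refine hM.isTProper.2 I hIM hIfg fun u hu => ?_
  refine isCompletelyIntegrallyClosed_iff.1 h u a ha fun n =>
    mem_range_of_forall_isMaximalTIdeal fun N hN => ?_
  have := hN.isPrime
  by_cases hNM : N = M
  · subst hNM
    obtain ⟨s, hs, r, hr⟩ := hcon n
    refine ⟨s, hs, ?_⟩
    have := congrArg (algebraMap R K) hr
    simp only [map_mul, map_pow] at this
    have heq : algebraMap R K a * u ^ n * algebraMap R K s =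
        (u * algebraMap R K c) ^ n * algebraMap R K r := by
      rw [mul_pow]
      linear_combination u ^ n * this
    rw [heq]
    exact mul_mem (pow_mem (hu c hc) n) ⟨r, rfl⟩
  · have hIN : ¬ I ≤ N := fun hle => hNM ((hL N ⟨hN, hle⟩).trans (hL M ⟨hM, hIM⟩).symm)
    obtain ⟨i, hi, hiN⟩ := SetLike.not_le_iff_exists.1 hIN
    refine ⟨i ^ n, fun h => hiN (‹N.IsPrime›.mem_of_pow_mem n h), ?_⟩
    rw [map_pow, mul_assoc, ← mul_pow]
    exact mul_mem ⟨a, rfl⟩ (pow_mem (hu i hi) n)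

/-- A nonzero `q ∈ Q` is not divisible by all powers of `c`, so it divides one of them at `M`; thus
`c ∈ Q`, and `c` generates `I` at `M`. -/
theorem IsCompletelyIntegrallyClosed.le_of_isTSuperRigid (h : IsCompletelyIntegrallyClosed R K)
    {I : Ideal R} (hI : IsTSuperRigid K I) {M : Ideal R} (hM : IsMaximalTIdeal K M) (hIM : I ≤ M)
    {Q : Ideal R} [hQ : Q.IsPrime] (hQ0 : Q ≠ ⊥) (hQM : Q ≤ M) : I ≤ Q := by
  have := hM.isPrime
  obtain ⟨c, hcI, -, ⟨s, hs, hcs⟩, hc⟩ := hI.exists_generator hM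
  obtain ⟨q, hq, hq0⟩ := Submodule.exists_mem_ne_zero_of_ne_bot hQ0
  obtain ⟨n, hn⟩ := h.not_pow_dvdAt hI.1 hM hIM hcI hq0
  have hcomp : ∀ x : R, DvdAt M c x ∨ DvdAt M x c := fun x => by
    rcases hc c x with h | h | h
    · exact .inl h
    · exact .inr h
    · exact .inl h.2
  obtain ⟨k, hk⟩ := exists_dvdAt_pow hcomp n hn
  have hcQ : c ∈ Q := hQ.mem_of_pow_mem k (hk.mem_of_le hQM hq)
  exact fun x hx => DvdAt.mem_of_le hQM ⟨s, hs, hcs x hx⟩ hcQ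

theorem IsTSuperRigid.of_le {I J : Ideal R} (hI : IsTSuperRigid K I) {M : Ideal R}
    (hM : IsMaximalTIdeal K M) (hIJ : I ≤ J) (hJM : J ≤ M) (hJ : J.FG) : IsTSuperRigid K J := by
  obtain ⟨⟨hI0, -, L, -, hL⟩, hinv⟩ := hI
  refine ⟨⟨fun h => hI0 (le_bot_iff.1 (h ▸ hIJ)), hJ, M, ⟨hM, hJM⟩, fun N hN => ?_⟩,
    fun A hA hJA => hinv A hA (hIJ.trans hJA)⟩
  exact (hL N ⟨hN.1, hIJ.trans hN.2⟩).trans (hL M ⟨hM, hIJ.trans hJM⟩).symm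

/-- Adding any `m ∈ M` to a `t`-super rigid ideal of `M` keeps it `t`-super rigid, so a nonzero
prime inside `M` contains every `m`. -/
theorem IsCompletelyIntegrallyClosed.hasTDimensionOne (h : IsCompletelyIntegrallyClosed R K)
    (hpot : IsTSuperPotent R K) : HasTDimensionOne R K := by
  intro M hM
  have := hM.isPrime
  obtain ⟨I, hI, hIM⟩ := hpot M hM
  refine height_eq_one_of_forall hM.prop.1 fun Q hQ hQ0 hQM m hm => ?_
  have hle : I ⊔ Ideal.span {m} ≤ M := sup_le hIM ((Ideal.span_singleton_le_iff_mem M).2 hm)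
  exact h.le_of_isTSuperRigid (hI.of_le hM le_sup_left hle
    (Submodule.FG.sup hI.1.2.1 (Submodule.fg_span_singleton m))) hM hle hQ0 hQM
    (Ideal.mem_sup_right (Ideal.mem_span_singleton_self m))

end TOperation

theorem theorem5p9 (R K : Type*) [CommRing R] [IsDomain R] [Field K] [Algebra R K]
    [IsFractionRing R K] :
    List.TFAE [
      TOperation.IsGeneralizedKrullDomain R K,
      TOperation.IsTPotent R K ∧ TOperation.IsEssentialDomain R K ∧
        TOperation.HasTDimensionOne R K,
      TOperation.IsTPotent R K ∧ TOperation.IsPvMD R K ∧ TOperation.HasTDimensionOne R K,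
      TOperation.IsCompletelyIntegrallyClosed R K ∧ TOperation.IsTSuperPotent R K,
      TOperation.IsTSuperPotent R K ∧ TOperation.HasTDimensionOne R K] := by
  tfae_have 1 → 2 := fun h => ⟨h.isTPotent, h.isEssentialDomain, h.hasTDimensionOne⟩
  tfae_have 2 → 3 := fun ⟨hp, he, hd⟩ => ⟨hp, he.isPvMD hp hd, hd⟩
  tfae_have 3 → 5 := fun ⟨hp, hv, hd⟩ => ⟨hv.isTSuperPotent hp, hd⟩
  tfae_have 5 → 1 := fun ⟨hs, hd⟩ => hs.isGeneralizedKrullDomain hd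
  tfae_have 5 → 4 := fun ⟨hs, hd⟩ => ⟨hs.isCompletelyIntegrallyClosed hd, hs⟩
  tfae_have 4 → 5 := fun ⟨hc, hs⟩ => ⟨hs, hc.hasTDimensionOne hs⟩
  tfae_finish
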